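/- Consider the semilinear hyperbolic system on $x\in[0,1]$, $t\ge 0$, with $w=(u,v)$, $$u_t=-\lambda^u(x)u_x+f^u(w,x),\quad v_t=\lambda^v(x)v_x+f^v(w,x),\quad u(0,t)=g(v(0,t),t),\quad v(1,t)=U(t),\quad w(\cdot,0)=w_0,$$ where $\lambda^u,\lambda^v\in L^\infty([0,1])$ are positive and bounded away from $0$; $f^u(\cdot,x)$, $f^v(\cdot,x)$ and $g(\cdot,t)$ are globally Lipschitz, uniformly in $x\in[0,1]$ and $t\ge0$; $f^u(0,x)=f^v(0,x)=0$ for $x\in[0,1]$ and $g(0,t)=0$ for $t\ge 0$; and $w_0\in L^\infty([0,1],\mathbb R^2)$. Solutions are locally bounded (in time) measurable broad solutions: the equations hold in integrated form along every characteristic line, the boundary conditions hold for every $t\ge0$, and the initial condition holds almost everywhere. Put $$\tau^u(x)=\int_0^x\frac{d\xi}{\lambda^u(\xi)},\qquad \tau^v(x)=\int_x^1\frac{d\xi}{\lambda^v(\xi)},$$ $$\mathcal A^u(t)=\{(x,s):x\in[0,1],\ s\in[t,t+\tau^v(x)]\},\qquad \mathcal A^v(t)=\{(x,s):x\in[0,1],\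 s\in[t,t+\tau^v(x))\}.$$ The predictive feedback assigns to a time $t\ge0$ and the state $w(\cdot,t)$ a control value as follows. (1) Solve the two transport equations and the boundary condition at $x=0$ with $w(\cdot,t)$ as initial condition at time $t$, for $u$ on $\mathcal A^u(t)$ and $v$ on $\mathcal A^v(t)$, and let $\bar u(x,t)$ be the value of the predicted $u$ at $(x,t+\tau^v(x))$. (2) Solve the ODE $$\bar v^*_x(x,t)=-\frac{f^v((\bar u(x,t),\bar v^*(x,t)),x)}{\lambda^v(x)},\qquad \bar v^*(0,t)=0,$$ on $[0,1]$. (3) Take the value $\bar v^*(1,t)$. Let $w$ be a solution of the system for some input $U$. Then for every $t\ge 0$ the feedback value for the state $w(\cdot,t)$ exists and is unique. If moreover $U(t)$ equals this value for every $t\ge0$ (closed loop), then $w(x,t)=0$ for all $x\in[0,1]$ and all $t\ge\tau^v(0)+\tau^u(1)$. -/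

import Mathlib

open Set MeasureTheory
open scoped NNReal ENNReal

noncomputable section

/-- Lebesgue measure on the spatial interval `[0,1]`. -/
abbrev unitVol : Measure ℝ := volume.restrict (Icc (0 : ℝ) 1)

/-- The data of the semilinear `2 × 2` system
`u_t = -lamU(x) u_x + fU(w,x)`, `v_t = lamV(x) v_x + fV(w,x)`, `u(0,t) = g(v(0,t),t)`,
where `w = (u,v)`. -/
structure HypSystem where
  lamU : ℝ → ℝ
  lamV : ℝ → ℝ
  fU : ℝ × ℝ → ℝ → ℝ
  fV : ℝ × ℝ → ℝ → ℝ
  g : ℝ → ℝ → ℝ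

namespace HypSystem

/-- Standing assumptions on the data: the speeds are measurable, bounded above and bounded away
from zero; the nonlinearities are Lipschitz in the state, uniformly in the other argument (and
`fU`, `fV` are measurable in `x`); the origin is an equilibrium. -/
structure Admissible (S : HypSystem) : Prop where
  lamU_meas : AEMeasurable S.lamU unitVol
  lamV_meas : AEMeasurable S.lamV unitVol
  speeds_lower : ∃ c > 0, ∀ᵐ x ∂unitVol, c ≤ S.lamU x ∧ c ≤ S.lamV x
  speeds_upper : ∃ C, ∀ᵐ x ∂unitVol, S.lamU x ≤ C ∧ S.lamV x ≤ C
  fU_meas : ∀ w, AEMeasurable (fun x => S.fU w x) unitVol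
  fV_meas : ∀ w, AEMeasurable (fun x => S.fV w x) unitVol
  f_lipschitz : ∃ L : ℝ≥0, ∀ᵐ x ∂unitVol,
    LipschitzWith L (fun w => S.fU w x) ∧ LipschitzWith L (fun w => S.fV w x)
  g_lipschitz : ∃ L : ℝ≥0, ∀ t, 0 ≤ t → LipschitzWith L (fun y => S.g y t)
  f_zero : ∀ x ∈ Icc (0 : ℝ) 1, S.fU 0 x = 0 ∧ S.fV 0 x = 0
  g_zero : ∀ t, 0 ≤ t → S.g 0 t = 0

/-- Travel time `τᵘ(x)` of `u` from `0` to `x`. -/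
def tauU (S : HypSystem) (x : ℝ) : ℝ := ∫ ξ in (0 : ℝ)..x, 1 / S.lamU ξ

/-- Travel time `τᵛ(x)` of `v` from `1` to `x`. -/
def tauV (S : HypSystem) (x : ℝ) : ℝ := ∫ ξ in x..(1 : ℝ), 1 / S.lamV ξ

/-- The space-time domain `[0,1] × [0,∞)`; points are written `(x, s)`. -/
def strip : Set (ℝ × ℝ) := {p | p.1 ∈ Icc (0 : ℝ) 1 ∧ 0 ≤ p.2}

/-- The determinate set `𝒜ᵘ(t)`. -/
def detU (S : HypSystem) (t : ℝ) : Set (ℝ × ℝ) :=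
  {p | p.1 ∈ Icc (0 : ℝ) 1 ∧ p.2 ∈ Icc t (t + S.tauV p.1)}

/-- The determinate set `𝒜ᵛ(t)`. -/
def detV (S : HypSystem) (t : ℝ) : Set (ℝ × ℝ) :=
  {p | p.1 ∈ Icc (0 : ℝ) 1 ∧ p.2 ∈ Ico t (t + S.tauV p.1)}

/-- `(u,v)` is a broad solution of the two transport equations with the boundary condition at
`x = 0`, where `u` lives on `Du` and `v` lives on `Dv`: both are measurable and bounded for bounded
times, and the equations, integrated along characteristic lines, hold along every characteristic
segment in the domain. The `u`-characteristics are the graphs `s = c + τᵘ(ξ)`, on which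
`du/dξ = fU / lamU`; the `v`-characteristics are the graphs `s = c + τᵛ(ξ)`, on which
`dv/dξ = - fV / lamV`. -/
structure IsBroadSolution (S : HypSystem) (Du Dv : Set (ℝ × ℝ)) (u v : ℝ → ℝ → ℝ) : Prop where
  meas_u : Measurable (Du.domRestrict (Function.uncurry u))
  meas_v : Measurable (Dv.domRestrict (Function.uncurry v))
  bdd_u : ∀ T : ℝ, ∃ M, ∀ p ∈ Du, p.2 ≤ T → |u p.1 p.2| ≤ M
  bdd_v : ∀ T : ℝ, ∃ M, ∀ p ∈ Dv, p.2 ≤ T → |v p.1 p.2| ≤ M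
  eq_u : ∀ c x₁ x₂ : ℝ, x₁ ≤ x₂ → (∀ ξ ∈ Icc x₁ x₂, (ξ, c + S.tauU ξ) ∈ Du) →
    u x₂ (c + S.tauU x₂) = u x₁ (c + S.tauU x₁) +
      ∫ ξ in x₁..x₂, S.fU (u ξ (c + S.tauU ξ), v ξ (c + S.tauU ξ)) ξ / S.lamU ξ
  eq_v : ∀ c x₁ x₂ : ℝ, x₁ ≤ x₂ → (∀ ξ ∈ Icc x₁ x₂, (ξ, c + S.tauV ξ) ∈ Dv) →
    v x₁ (c + S.tauV x₁) = v x₂ (c + S.tauV x₂) +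
      ∫ ξ in x₁..x₂, S.fV (u ξ (c + S.tauV ξ), v ξ (c + S.tauV ξ)) ξ / S.lamV ξ
  bc_zero : ∀ s, (0, s) ∈ Du → (0, s) ∈ Dv → u 0 s = S.g (v 0 s) s

/-- `(u,v)` is a broad solution on `[0,1] × [0,∞)` of the system with input `U` and initial
condition `w₀`. As `w₀` is an element of `L^∞`, the initial condition is an equality almost
everywhere; the boundary conditions hold at every time `t ≥ 0`. -/
structure IsSolution (S : HypSystem) (w₀ : ℝ → ℝ × ℝ) (U : ℝ → ℝ) (u v : ℝ → ℝ → ℝ) :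
    Prop where
  broad : S.IsBroadSolution strip strip u v
  bc_one : ∀ t, 0 ≤ t → v 1 t = U t
  init : ∀ᵐ x ∂unitVol, (u x 0, v x 0) = w₀ x

/-- `(u,v)` is a prediction at time `t` from the state `(p,q)`: it solves the Cauchy problem on the
determinate sets `𝒜ᵘ(t)`, `𝒜ᵛ(t)` with `(p,q)` as initial condition at time `t`. At the corner
`(0,t)` the value of `u` is given by the boundary condition. -/
structure IsPrediction (S : HypSystem) (t : ℝ) (p q : ℝ → ℝ) (u v : ℝ → ℝ → ℝ) : Prop where
  broad : S.IsBroadSolution (S.detU t) (S.detV t) u v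
  init_u : ∀ x ∈ Ioc (0 : ℝ) 1, u x t = p x
  init_v : ∀ x ∈ Ico (0 : ℝ) 1, v x t = q x

/-- `y` is the (Carathéodory) solution on `[0,1]` of the target system
`y_x = - fV((ubar(x), y(x)), x) / lamV(x)`, `y(0) = 0`. -/
structure IsTarget (S : HypSystem) (ubar : ℝ → ℝ) (y : ℝ → ℝ) : Prop where
  cont : ContinuousOn y (Icc 0 1)
  eq : ∀ x ∈ Icc (0 : ℝ) 1, y x = -∫ ξ in (0 : ℝ)..x, S.fV (ubar ξ, y ξ) ξ / S.lamV ξ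

/-- `a` is the control value produced by the predictive feedback at time `t` in the state `(p,q)`:
predict `u` on `𝒜ᵘ(t)`, put `ubar(x) = u(x, t + τᵛ(x))`, solve the target system, and take the
value of its solution at `x = 1`. -/
def IsFeedbackValue (S : HypSystem) (t : ℝ) (p q : ℝ → ℝ) (a : ℝ) : Prop :=
  ∃ (u v : ℝ → ℝ → ℝ) (y : ℝ → ℝ), S.IsPrediction t p q u v ∧
    S.IsTarget (fun x => u x (t + S.tauV x)) y ∧ a = y 1

end HypSystem

end

/-!
Integrated along characteristics, all equations become fixed point equations whose integral
operators are Lipschitz. In a suitable exponential weight each operator halves every bound on the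
difference of two solutions, so differences vanish (`bound_div_two_pow`, applied to the estimates
`IsBroadSolution.abs_sub_u_le` and its analogues for `v`). Pointwise suprema suffice for this
argument; measurability is needed only for traces along single characteristics, where it makes the
integrals of the composed nonlinearities genuine (`IsCoefficient.intervalIntegrable_comp`).

*Existence and uniqueness of the feedback value.* The solution itself, restricted to the determinate
sets, is a prediction. Any other prediction agrees with it except possibly for `u` at the corner
`(0, t + τᵛ(0))` (`IsPrediction.unique`, with weights exponential in time), and that point does not
influence the target equation. The target equation is a Carathéodory ODE with Lipschitz right-hand
side: it is solved by a contraction of `C([0,1])` (`IsCoefficient.exists_target`), uniquely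
(`IsCoefficient.eq_of_forward`).

*Finite-time convergence.* Along the characteristic `s = t + τᵛ(x)` the actual `v` satisfies the
target equation, and by the choice of the control it has the value of the target solution at
`x = 1`. Uniqueness backwards from `x = 1` (`IsCoefficient.eq_of_backward`) gives
`v(0, t + τᵛ(0)) = 0`. Hence `u` and `v` vanish at `x = 0` for all `s ≥ τᵛ(0)`. Taking `x` as the
evolution variable, uniqueness against the zero solution propagates this to all
`s ≥ τᵛ(0) + τᵘ(x)` (`IsBroadSolution.eq_zero_of_v_zero`).
-/

open Filter Topology

/-! ### Scalar coefficients along a characteristic -/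

/-- A Carathéodory function composed with a measurable function is measurable. -/
theorem aemeasurable_caratheodory_comp {f : ℝ × ℝ → ℝ → ℝ} {μ : Measure ℝ} {w : ℝ → ℝ × ℝ}
    (hf : ∀ a, AEMeasurable (f a) μ) (hc : ∀ᵐ x ∂μ, Continuous fun a => f a x)
    (hw : AEMeasurable w μ) : AEMeasurable (fun x => f (w x) x) μ := by
  have hw' : StronglyMeasurable (hw.mk w) := hw.measurable_mk.stronglyMeasurable
  have hs : ∀ n, AEMeasurable (fun x => f (hw'.approx n x) x) μ := by
    intro n
    have heq : (fun x => f (hw'.approx n x) x) = fun x => ∑ a ∈ (hw'.approx n).range,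
        ((hw'.approx n) ⁻¹' {a}).indicator (f a) x := by
      funext x
      rw [Finset.sum_eq_single (hw'.approx n x)]
      · simp
      · intro b _ hb
        exact indicator_of_notMem (fun h => hb h.symm) _
      · intro h
        exact absurd (SimpleFunc.mem_range_self _ x) h
    rw [heq]
    exact Finset.aemeasurable_fun_sum _ fun a _ =>
      (hf a).indicator ((hw'.approx n).measurableSet_fiber a)
  refine aemeasurable_of_tendsto_metrizable_ae atTop hs ?_
  filter_upwards [hc, hw.ae_eq_mk] with x hx hwx
  rw [hwx]
  exact (hx.tendsto _).comp (hw'.tendsto_approx x)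

/-- The coefficients of one scalar equation `λ y' = ± f(w, ξ)` on `[0,1]`: the speed `lam` takes
values in `[c, C]`, and `f` is a Carathéodory function, `L`-Lipschitz in the state and zero at the
equilibrium. -/
structure IsCoefficient (f : ℝ × ℝ → ℝ → ℝ) (lam : ℝ → ℝ) (c C L : ℝ) : Prop where
  c_pos : 0 < c
  C_pos : 0 < C
  L_nonneg : 0 ≤ L
  lam_meas : AEMeasurable lam unitVol
  f_meas : ∀ w, AEMeasurable (f w) unitVol
  bounds : ∀ᵐ x ∂unitVol, c ≤ lam x ∧ lam x ≤ C ∧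
    (∀ w w', |f w x - f w' x| ≤ L * ‖w - w'‖) ∧ f 0 x = 0

/-- A bounded measurable state along the part of a characteristic over `(x₁, x₂)`. The end points
are left out: there a prediction of `v` may be outside its domain. -/
def IsTame (w : ℝ → ℝ × ℝ) (x₁ x₂ : ℝ) : Prop :=
  AEMeasurable w (volume.restrict (Ioo x₁ x₂)) ∧ ∃ M, ∀ ξ ∈ Ioo x₁ x₂, ‖w ξ‖ ≤ M

namespace IsCoefficient

variable {f : ℝ × ℝ → ℝ → ℝ} {lam : ℝ → ℝ} {c C L x₁ x₂ : ℝ} {w w' : ℝ → ℝ × ℝ}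

theorem restrict_Ioo_le (h₁ : 0 ≤ x₁) (h₂ : x₂ ≤ 1) :
    volume.restrict (Ioo x₁ x₂) ≤ unitVol :=
  Measure.restrict_mono_set _ (Ioo_subset_Icc_self.trans (Icc_subset_Icc h₁ h₂))

theorem ae_Ioo (h : IsCoefficient f lam c C L) (h₁ : 0 ≤ x₁) (h₂ : x₂ ≤ 1) :
    ∀ᵐ x ∂volume.restrict (Ioo x₁ x₂), c ≤ lam x ∧ lam x ≤ C ∧
      (∀ w w', |f w x - f w' x| ≤ L * ‖w - w'‖) ∧ f 0 x = 0 :=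
  ae_mono (restrict_Ioo_le h₁ h₂) h.bounds

theorem aemeasurable_comp (h : IsCoefficient f lam c C L) (h₁ : 0 ≤ x₁) (h₂ : x₂ ≤ 1)
    (hw : IsTame w x₁ x₂) :
    AEMeasurable (fun ξ => f (w ξ) ξ / lam ξ) (volume.restrict (Ioo x₁ x₂)) := by
  have hm := restrict_Ioo_le h₁ h₂
  refine (aemeasurable_caratheodory_comp (fun a => (h.f_meas a).mono_measure hm) ?_ hw.1).div
    (h.lam_meas.mono_measure hm)
  filter_upwards [h.ae_Ioo h₁ h₂] with x hx
  refine (LipschitzWith.of_dist_le_mul (K := L.toNNReal) fun a b => ?_).continuous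
  rw [Real.dist_eq, dist_eq_norm, Real.coe_toNNReal _ h.L_nonneg]
  exact hx.2.2.1 a b

theorem intervalIntegrable_comp (h : IsCoefficient f lam c C L) (h₁ : 0 ≤ x₁) (h₂ : x₂ ≤ 1)
    (h₁₂ : x₁ ≤ x₂) (hw : IsTame w x₁ x₂) :
    IntervalIntegrable (fun ξ => f (w ξ) ξ / lam ξ) volume x₁ x₂ := by
  rw [intervalIntegrable_iff_integrableOn_Ioo_of_le h₁₂]
  obtain ⟨M, hM⟩ := hw.2
  refine Integrable.of_bound (h.aemeasurable_comp h₁ h₂ hw).aestronglyMeasurable (L * M / c) ?_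
  filter_upwards [h.ae_Ioo h₁ h₂, ae_restrict_mem measurableSet_Ioo] with x hx hxm
  have h0 := hx.2.2.1 (w x) 0
  rw [hx.2.2.2, sub_zero, sub_zero] at h0
  have hc := h.c_pos
  rw [Real.norm_eq_abs, abs_div, abs_of_pos (hc.trans_le hx.1)]
  exact div_le_div₀ ((abs_nonneg _).trans (h0.trans (by gcongr; exacts [h.L_nonneg, hM x hxm])))
    (h0.trans (by gcongr; exacts [h.L_nonneg, hM x hxm])) hc hx.1

/-- Lipschitz dependence of the integral along a characteristic on the state. -/
theorem abs_integral_sub_le (h : IsCoefficient f lam c C L) (h₁ : 0 ≤ x₁) (h₂ : x₂ ≤ 1)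
    (h₁₂ : x₁ ≤ x₂) (hw : IsTame w x₁ x₂) (hw' : IsTame w' x₁ x₂) {β : ℝ → ℝ}
    (hβ : Continuous β) (hle : ∀ ξ ∈ Ioo x₁ x₂, ‖w ξ - w' ξ‖ ≤ β ξ) :
    |(∫ ξ in x₁..x₂, f (w ξ) ξ / lam ξ) - ∫ ξ in x₁..x₂, f (w' ξ) ξ / lam ξ|
      ≤ L / c * ∫ ξ in x₁..x₂, β ξ := by
  rw [← intervalIntegral.integral_sub (h.intervalIntegrable_comp h₁ h₂ h₁₂ hw)
    (h.intervalIntegrable_comp h₁ h₂ h₁₂ hw'), ← intervalIntegral.integral_const_mul,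
    ← Real.norm_eq_abs]
  refine intervalIntegral.norm_integral_le_of_norm_le h₁₂ ?_
    ((continuous_const.mul hβ).intervalIntegrable _ _)
  rw [← ae_restrict_iff' measurableSet_Ioc,
    ← Measure.restrict_congr_set (Ioo_ae_eq_Ioc (μ := volume) (a := x₁) (b := x₂))]
  filter_upwards [h.ae_Ioo h₁ h₂, ae_restrict_mem measurableSet_Ioo] with x hx hxm
  have h0 := (hx.2.2.1 (w x) (w' x)).trans (mul_le_mul_of_nonneg_left (hle x hxm) h.L_nonneg)
  have hc := h.c_pos
  rw [← sub_div, Real.norm_eq_abs, abs_div, abs_of_pos (hc.trans_le hx.1), div_mul_eq_mul_div]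
  exact div_le_div₀ ((abs_nonneg _).trans h0) h0 hc hx.1

theorem integral_exp_left_le {κ B : ℝ} (hκ : 0 < κ) (hB : 0 ≤ B) :
    ∫ ξ in x₁..x₂, B * Real.exp (-(κ * (x₂ - ξ))) ≤ B / κ := by
  have hd : ∀ ξ ∈ uIcc x₁ x₂, HasDerivAt (fun ξ => B / κ * Real.exp (-(κ * (x₂ - ξ))))
      (B * Real.exp (-(κ * (x₂ - ξ)))) ξ := by
    intro ξ _
    have h1 : HasDerivAt (fun ξ => -(κ * (x₂ - ξ))) κ ξ := by
      simpa using (((hasDerivAt_id ξ).const_sub x₂).const_mul κ).fun_neg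
    have h2 := (h1.exp).const_mul (B / κ)
    convert! h2 using 1
    field_simp
  rw [intervalIntegral.integral_eq_sub_of_hasDerivAt hd
    ((by fun_prop : Continuous _).intervalIntegrable _ _)]
  simp only [sub_self, mul_zero, neg_zero, Real.exp_zero, mul_one]
  have : 0 ≤ B / κ * Real.exp (-(κ * (x₂ - x₁))) := by positivity
  linarith

theorem integral_exp_right_le {κ B : ℝ} (hκ : 0 < κ) (hB : 0 ≤ B) :
    ∫ ξ in x₁..x₂, B * Real.exp (-(κ * (ξ - x₁))) ≤ B / κ := by
  have hd : ∀ ξ ∈ uIcc x₁ x₂, HasDerivAt (fun ξ => -(B / κ) * Real.exp (-(κ * (ξ - x₁))))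
      (B * Real.exp (-(κ * (ξ - x₁)))) ξ := by
    intro ξ _
    have h1 : HasDerivAt (fun ξ => -(κ * (ξ - x₁))) (-κ) ξ := by
      simpa using (((hasDerivAt_id ξ).sub_const x₁).const_mul κ).fun_neg
    have h2 := (h1.exp).const_mul (-(B / κ))
    convert! h2 using 1
    field_simp
  rw [intervalIntegral.integral_eq_sub_of_hasDerivAt hd
    ((by fun_prop : Continuous _).intervalIntegrable _ _)]
  simp only [sub_self, mul_zero, neg_zero, Real.exp_zero, mul_one]
  have : 0 ≤ B / κ * Real.exp (-(κ * (x₂ - x₁))) := by positivity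
  linarith

/-- Exponential weights decaying away from the right end point make the integral operator
a contraction for large `κ`. -/
theorem abs_integral_sub_le_left (h : IsCoefficient f lam c C L) (h₁ : 0 ≤ x₁) (h₂ : x₂ ≤ 1)
    (h₁₂ : x₁ ≤ x₂) (hw : IsTame w x₁ x₂) (hw' : IsTame w' x₁ x₂) {κ B : ℝ} (hκ : 0 < κ)
    (hB : 0 ≤ B)
    (hle : ∀ ξ ∈ Ioo x₁ x₂, ‖w ξ - w' ξ‖ ≤ B * Real.exp (-(κ * (x₂ - ξ)))) :
    |(∫ ξ in x₁..x₂, f (w ξ) ξ / lam ξ) - ∫ ξ in x₁..x₂, f (w' ξ) ξ / lam ξ|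
      ≤ L / c * (B / κ) :=
  (h.abs_integral_sub_le h₁ h₂ h₁₂ hw hw' (by fun_prop) hle).trans
    (mul_le_mul_of_nonneg_left (integral_exp_left_le hκ hB) (div_nonneg h.L_nonneg h.c_pos.le))

/-- The counterpart of `abs_integral_sub_le_left` for weights decaying away from the left end
point. -/
theorem abs_integral_sub_le_right (h : IsCoefficient f lam c C L) (h₁ : 0 ≤ x₁) (h₂ : x₂ ≤ 1)
    (h₁₂ : x₁ ≤ x₂) (hw : IsTame w x₁ x₂) (hw' : IsTame w' x₁ x₂) {κ B : ℝ} (hκ : 0 < κ)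
    (hB : 0 ≤ B)
    (hle : ∀ ξ ∈ Ioo x₁ x₂, ‖w ξ - w' ξ‖ ≤ B * Real.exp (-(κ * (ξ - x₁)))) :
    |(∫ ξ in x₁..x₂, f (w ξ) ξ / lam ξ) - ∫ ξ in x₁..x₂, f (w' ξ) ξ / lam ξ|
      ≤ L / c * (B / κ) :=
  (h.abs_integral_sub_le h₁ h₂ h₁₂ hw hw' (by fun_prop) hle).trans
    (mul_le_mul_of_nonneg_left (integral_exp_right_le hκ hB) (div_nonneg h.L_nonneg h.c_pos.le))

theorem intervalIntegrable_inv (h : IsCoefficient f lam c C L) (h₁ : 0 ≤ x₁) (h₂ : x₂ ≤ 1)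
    (h₁₂ : x₁ ≤ x₂) : IntervalIntegrable (fun ξ => 1 / lam ξ) volume x₁ x₂ := by
  rw [intervalIntegrable_iff_integrableOn_Ioo_of_le h₁₂]
  refine Integrable.of_bound
    ((h.lam_meas.mono_measure (restrict_Ioo_le h₁ h₂)).const_div 1).aestronglyMeasurable (1 / c) ?_
  filter_upwards [h.ae_Ioo h₁ h₂] with x hx
  have hc := h.c_pos
  rw [Real.norm_eq_abs, abs_of_nonneg (one_div_nonneg.2 (hc.le.trans hx.1))]
  exact one_div_le_one_div_of_le hc hx.1

theorem travel_bounds (h : IsCoefficient f lam c C L) (h₁ : 0 ≤ x₁) (h₂ : x₂ ≤ 1)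
    (h₁₂ : x₁ ≤ x₂) : (x₂ - x₁) / C ≤ ∫ ξ in x₁..x₂, 1 / lam ξ ∧
      ∫ ξ in x₁..x₂, 1 / lam ξ ≤ (x₂ - x₁) / c := by
  have hi := h.intervalIntegrable_inv h₁ h₂ h₁₂
  have hae : ∀ᵐ x ∂volume.restrict (Icc x₁ x₂), 1 / C ≤ 1 / lam x ∧ 1 / lam x ≤ 1 / c := by
    rw [← Measure.restrict_congr_set (Ioo_ae_eq_Icc (μ := volume) (a := x₁) (b := x₂))]
    filter_upwards [h.ae_Ioo h₁ h₂] with x hx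
    exact ⟨one_div_le_one_div_of_le (h.c_pos.trans_le hx.1) hx.2.1,
      one_div_le_one_div_of_le h.c_pos hx.1⟩
  constructor
  · calc (x₂ - x₁) / C = ∫ _ in x₁..x₂, 1 / C := by simp [div_eq_mul_inv]
      _ ≤ _ := intervalIntegral.integral_mono_ae_restrict h₁₂ (by simp) hi
        (hae.mono fun x hx => hx.1)
  · calc ∫ ξ in x₁..x₂, 1 / lam ξ ≤ ∫ _ in x₁..x₂, 1 / c :=
          intervalIntegral.integral_mono_ae_restrict h₁₂ hi (by simp) (hae.mono fun x hx => hx.2)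
      _ = (x₂ - x₁) / c := by simp [div_eq_mul_inv]

end IsCoefficient

namespace HypSystem

variable {S : HypSystem}

/-- Uniform constants for both transport equations of an admissible system. -/
theorem Admissible.exists_isCoefficient (hS : S.Admissible) : ∃ c C L : ℝ,
    IsCoefficient S.fU S.lamU c C L ∧ IsCoefficient S.fV S.lamV c C L := by
  obtain ⟨c, hc, hlow⟩ := hS.speeds_lower
  obtain ⟨C, hup⟩ := hS.speeds_upper
  obtain ⟨L, hL⟩ := hS.f_lipschitz
  have hmem : ∀ᵐ x ∂unitVol, x ∈ Icc (0 : ℝ) 1 := ae_restrict_mem measurableSet_Icc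
  have hd : ∀ a b : ℝ × ℝ, ∀ f : ℝ × ℝ → ℝ, LipschitzWith L f → |f a - f b| ≤ L * ‖a - b‖ := by
    intro a b f hf
    have := hf.dist_le_mul a b
    rwa [Real.dist_eq, dist_eq_norm] at this
  refine ⟨c, max C 1, L, ⟨hc, by positivity, L.2, hS.lamU_meas, hS.fU_meas, ?_⟩,
    ⟨hc, by positivity, L.2, hS.lamV_meas, hS.fV_meas, ?_⟩⟩
  · filter_upwards [hlow, hup, hL, hmem] with x h1 h2 h3 h4
    exact ⟨h1.1, h2.1.trans (le_max_left _ _), fun a b => hd a b _ h3.1, (hS.f_zero x h4).1⟩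
  · filter_upwards [hlow, hup, hL, hmem] with x h1 h2 h3 h4
    exact ⟨h1.2, h2.2.trans (le_max_left _ _), fun a b => hd a b _ h3.2, (hS.f_zero x h4).2⟩

/-! ### Travel times -/

variable {c C L x₁ x₂ : ℝ}

theorem tauU_bounds (h : IsCoefficient S.fU S.lamU c C L) (h₁ : 0 ≤ x₁) (h₂ : x₂ ≤ 1)
    (h₁₂ : x₁ ≤ x₂) : (x₂ - x₁) / C ≤ S.tauU x₂ - S.tauU x₁ ∧
      S.tauU x₂ - S.tauU x₁ ≤ (x₂ - x₁) / c := by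
  have := h.travel_bounds h₁ h₂ h₁₂
  rwa [← intervalIntegral.integral_interval_sub_left
    (h.intervalIntegrable_inv le_rfl h₂ (h₁.trans h₁₂))
    (h.intervalIntegrable_inv le_rfl (h₁₂.trans h₂) h₁)] at this

theorem tauV_bounds (h : IsCoefficient S.fV S.lamV c C L) (h₁ : 0 ≤ x₁) (h₂ : x₂ ≤ 1)
    (h₁₂ : x₁ ≤ x₂) : (x₂ - x₁) / C ≤ S.tauV x₁ - S.tauV x₂ ∧
      S.tauV x₁ - S.tauV x₂ ≤ (x₂ - x₁) / c := by
  have := h.travel_bounds h₁ h₂ h₁₂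
  have h3 := intervalIntegral.integral_add_adjacent_intervals
    (h.intervalIntegrable_inv h₁ h₂ h₁₂) (h.intervalIntegrable_inv (h₁.trans h₁₂) le_rfl h₂)
  unfold tauV
  rwa [← h3, add_sub_cancel_right]

theorem tauU_zero : S.tauU 0 = 0 := intervalIntegral.integral_same

theorem tauV_one : S.tauV 1 = 0 := intervalIntegral.integral_same

theorem continuousOn_of_bounds {τ : ℝ → ℝ} {K : ℝ}
    (h : ∀ x₁ x₂, 0 ≤ x₁ → x₂ ≤ 1 → x₁ ≤ x₂ → |τ x₂ - τ x₁| ≤ K * (x₂ - x₁)) :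
    ContinuousOn τ (Icc 0 1) := by
  refine (LipschitzOnWith.of_dist_le_mul (K := K.toNNReal) fun x hx y hy => ?_).continuousOn
  have hK := Real.le_coe_toNNReal K
  rcases le_total x y with hxy | hxy
  · rw [dist_comm, Real.dist_eq, dist_comm, Real.dist_eq, abs_of_nonneg (sub_nonneg.2 hxy)]
    exact (h x y hx.1 hy.2 hxy).trans (mul_le_mul_of_nonneg_right hK (sub_nonneg.2 hxy))
  · rw [Real.dist_eq, Real.dist_eq, abs_of_nonneg (sub_nonneg.2 hxy)]
    exact (h y x hy.1 hx.2 hxy).trans (mul_le_mul_of_nonneg_right hK (sub_nonneg.2 hxy))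

theorem continuousOn_tauU (h : IsCoefficient S.fU S.lamU c C L) :
    ContinuousOn S.tauU (Icc 0 1) := by
  refine continuousOn_of_bounds (K := 1 / c) fun x₁ x₂ h₁ h₂ h₁₂ => ?_
  have hb := tauU_bounds h h₁ h₂ h₁₂
  have : 0 ≤ (x₂ - x₁) / C := div_nonneg (sub_nonneg.2 h₁₂) h.C_pos.le
  rw [abs_of_nonneg (this.trans hb.1), one_div_mul_eq_div]
  exact hb.2

theorem continuousOn_tauV (h : IsCoefficient S.fV S.lamV c C L) :
    ContinuousOn S.tauV (Icc 0 1) := by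
  refine continuousOn_of_bounds (K := 1 / c) fun x₁ x₂ h₁ h₂ h₁₂ => ?_
  have hb := tauV_bounds h h₁ h₂ h₁₂
  have : 0 ≤ (x₂ - x₁) / C := div_nonneg (sub_nonneg.2 h₁₂) h.C_pos.le
  rw [abs_sub_comm, abs_of_nonneg (this.trans hb.1), one_div_mul_eq_div]
  exact hb.2

/-! ### Traces along characteristics -/

/-- The trace of a measurable function on `D` along a continuous curve in `D`. -/
theorem aemeasurable_trace {D : Set (ℝ × ℝ)} {z : ℝ → ℝ → ℝ}
    (hz : Measurable (D.domRestrict (Function.uncurry z))) {φ : ℝ → ℝ}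
    (hφ : ContinuousOn φ (Ioo x₁ x₂)) (hD : ∀ ξ ∈ Ioo x₁ x₂, (ξ, φ ξ) ∈ D) :
    AEMeasurable (fun ξ => z ξ (φ ξ)) (volume.restrict (Ioo x₁ x₂)) := by
  refine aemeasurable_restrict_of_measurable_subtype measurableSet_Ioo ?_
  have hm : Measurable fun ξ : Ioo x₁ x₂ => (⟨(ξ, φ ξ), hD ξ ξ.2⟩ : D) :=
    ((continuous_subtype_val.prodMk (continuousOn_iff_continuous_domRestrict.1 hφ)).subtype_mk
      _).measurable
  exact hz.comp hm

/-- States of a broad solution along a characteristic are bounded and measurable. -/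
theorem IsBroadSolution.isTame {Du Dv : Set (ℝ × ℝ)} {u v : ℝ → ℝ → ℝ}
    (h : S.IsBroadSolution Du Dv u v) {τ : ℝ → ℝ} (hτ : ContinuousOn τ (Icc 0 1))
    (h₁ : 0 ≤ x₁) (h₂ : x₂ ≤ 1) {a : ℝ} (hu : ∀ ξ ∈ Ioo x₁ x₂, (ξ, a + τ ξ) ∈ Du)
    (hv : ∀ ξ ∈ Ioo x₁ x₂, (ξ, a + τ ξ) ∈ Dv) :
    IsTame (fun ξ => (u ξ (a + τ ξ), v ξ (a + τ ξ))) x₁ x₂ := by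
  have hsub : Ioo x₁ x₂ ⊆ Icc 0 1 := fun x hx => ⟨h₁.trans hx.1.le, hx.2.le.trans h₂⟩
  have hc : ContinuousOn (fun ξ => a + τ ξ) (Ioo x₁ x₂) := continuousOn_const.add (hτ.mono hsub)
  refine ⟨(aemeasurable_trace h.meas_u hc hu).prodMk (aemeasurable_trace h.meas_v hc hv), ?_⟩
  obtain ⟨T, hT⟩ := isCompact_Icc.bddAbove_image hτ
  obtain ⟨M, hM⟩ := h.bdd_u (a + T)
  obtain ⟨N, hN⟩ := h.bdd_v (a + T)
  refine ⟨max M N, fun ξ hξ => ?_⟩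
  have : a + τ ξ ≤ a + T := add_le_add_right (hT (mem_image_of_mem _ (hsub hξ))) a
  exact max_le_max (hM _ (hu ξ hξ) this) (hN _ (hv ξ hξ) this)

end HypSystem

/-! ### Improvement of bounds by halving -/

/-- The argument behind all uniqueness proofs: a bound that holds with some constant and
improves by a factor `2` holds with arbitrarily small constants. -/
theorem bound_div_two_pow {P : ℝ → Prop} (hP : ∀ B, 0 ≤ B → P B → P (B / 2)) {B : ℝ} (hB : 0 ≤ B)
    (h : P B) (n : ℕ) : P (B / 2 ^ n) := by
  induction n with
  | zero => simpa using h
  | succ n ih =>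
    rw [pow_succ, ← div_div]
    exact hP _ (by positivity) ih

theorem eq_zero_of_le_div_two_pow {d B W : ℝ} (h : ∀ n : ℕ, |d| ≤ B / 2 ^ n * W) : d = 0 := by
  have ht : Tendsto (fun n : ℕ => B / 2 ^ n * W) atTop (𝓝 0) := by
    have := ((tendsto_pow_atTop_nhds_zero_of_lt_one (r := (1 / 2 : ℝ)) (by norm_num)
      (by norm_num)).const_mul B).mul_const W
    simpa [div_eq_mul_inv] using this
  exact abs_nonpos_iff.1 (ge_of_tendsto' ht h)

namespace HypSystem

variable {S : HypSystem} {c C L x₁ x₂ : ℝ}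

/-! ### Comparison of two broad solutions along characteristics -/

section Compare

variable {Du Dv : Set (ℝ × ℝ)} {u v u' v' : ℝ → ℝ → ℝ} {a κ B : ℝ}

theorem IsBroadSolution.abs_sub_u_le (h : S.IsBroadSolution Du Dv u v)
    (h' : S.IsBroadSolution Du Dv u' v') (hc : IsCoefficient S.fU S.lamU c C L)
    (h₁ : 0 ≤ x₁) (h₂ : x₂ ≤ 1) (h₁₂ : x₁ ≤ x₂)
    (hDu : ∀ ξ ∈ Icc x₁ x₂, (ξ, a + S.tauU ξ) ∈ Du)
    (hDv : ∀ ξ ∈ Ioo x₁ x₂, (ξ, a + S.tauU ξ) ∈ Dv) (hκ : 0 < κ) (hB : 0 ≤ B)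
    (hle : ∀ ξ ∈ Ioo x₁ x₂,
      |u ξ (a + S.tauU ξ) - u' ξ (a + S.tauU ξ)| ≤ B * Real.exp (-(κ * (x₂ - ξ))) ∧
      |v ξ (a + S.tauU ξ) - v' ξ (a + S.tauU ξ)| ≤ B * Real.exp (-(κ * (x₂ - ξ)))) :
    |u x₂ (a + S.tauU x₂) - u' x₂ (a + S.tauU x₂)| ≤
      |u x₁ (a + S.tauU x₁) - u' x₁ (a + S.tauU x₁)| + L / c * (B / κ) := by
  have hDu' := fun ξ hξ => hDu ξ (Ioo_subset_Icc_self hξ)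
  have hτ := continuousOn_tauU hc
  have key := hc.abs_integral_sub_le_left h₁ h₂ h₁₂ (h.isTame hτ h₁ h₂ hDu' hDv)
    (h'.isTame hτ h₁ h₂ hDu' hDv) hκ hB fun ξ hξ => max_le (hle ξ hξ).1 (hle ξ hξ).2
  rw [h.eq_u a x₁ x₂ h₁₂ hDu, h'.eq_u a x₁ x₂ h₁₂ hDu, add_sub_add_comm]
  exact (abs_add_le _ _).trans (add_le_add_right key _)

/-- Comparison along a `v`-characteristic in the direction of growing time. -/
theorem IsBroadSolution.abs_sub_v_le (h : S.IsBroadSolution Du Dv u v)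
    (h' : S.IsBroadSolution Du Dv u' v') (hc : IsCoefficient S.fV S.lamV c C L)
    (h₁ : 0 ≤ x₁) (h₂ : x₂ ≤ 1) (h₁₂ : x₁ ≤ x₂)
    (hDu : ∀ ξ ∈ Ioo x₁ x₂, (ξ, a + S.tauV ξ) ∈ Du)
    (hDv : ∀ ξ ∈ Icc x₁ x₂, (ξ, a + S.tauV ξ) ∈ Dv) (hκ : 0 < κ) (hB : 0 ≤ B)
    (hle : ∀ ξ ∈ Ioo x₁ x₂,
      |u ξ (a + S.tauV ξ) - u' ξ (a + S.tauV ξ)| ≤ B * Real.exp (-(κ * (ξ - x₁))) ∧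
      |v ξ (a + S.tauV ξ) - v' ξ (a + S.tauV ξ)| ≤ B * Real.exp (-(κ * (ξ - x₁)))) :
    |v x₁ (a + S.tauV x₁) - v' x₁ (a + S.tauV x₁)| ≤
      |v x₂ (a + S.tauV x₂) - v' x₂ (a + S.tauV x₂)| + L / c * (B / κ) := by
  have hDv' := fun ξ hξ => hDv ξ (Ioo_subset_Icc_self hξ)
  have hτ := continuousOn_tauV hc
  have key := hc.abs_integral_sub_le_right h₁ h₂ h₁₂ (h.isTame hτ h₁ h₂ hDu hDv')
    (h'.isTame hτ h₁ h₂ hDu hDv') hκ hB fun ξ hξ => max_le (hle ξ hξ).1 (hle ξ hξ).2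
  rw [h.eq_v a x₁ x₂ h₁₂ hDv, h'.eq_v a x₁ x₂ h₁₂ hDv, add_sub_add_comm]
  exact (abs_add_le _ _).trans (add_le_add_right key _)

/-- Comparison along a `v`-characteristic in the direction of growing `x`, against the flow of
time. -/
theorem IsBroadSolution.abs_sub_v_le' (h : S.IsBroadSolution Du Dv u v)
    (h' : S.IsBroadSolution Du Dv u' v') (hc : IsCoefficient S.fV S.lamV c C L)
    (h₁ : 0 ≤ x₁) (h₂ : x₂ ≤ 1) (h₁₂ : x₁ ≤ x₂)
    (hDu : ∀ ξ ∈ Ioo x₁ x₂, (ξ, a + S.tauV ξ) ∈ Du)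
    (hDv : ∀ ξ ∈ Icc x₁ x₂, (ξ, a + S.tauV ξ) ∈ Dv) (hκ : 0 < κ) (hB : 0 ≤ B)
    (hle : ∀ ξ ∈ Ioo x₁ x₂,
      |u ξ (a + S.tauV ξ) - u' ξ (a + S.tauV ξ)| ≤ B * Real.exp (-(κ * (x₂ - ξ))) ∧
      |v ξ (a + S.tauV ξ) - v' ξ (a + S.tauV ξ)| ≤ B * Real.exp (-(κ * (x₂ - ξ)))) :
    |v x₂ (a + S.tauV x₂) - v' x₂ (a + S.tauV x₂)| ≤
      |v x₁ (a + S.tauV x₁) - v' x₁ (a + S.tauV x₁)| + L / c * (B / κ) := by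
  have hDv' := fun ξ hξ => hDv ξ (Ioo_subset_Icc_self hξ)
  have hτ := continuousOn_tauV hc
  have key := hc.abs_integral_sub_le_left h₁ h₂ h₁₂ (h.isTame hτ h₁ h₂ hDu hDv')
    (h'.isTame hτ h₁ h₂ hDu hDv') hκ hB fun ξ hξ => max_le (hle ξ hξ).1 (hle ξ hξ).2
  rw [h.eq_v a x₁ x₂ h₁₂ hDv, h'.eq_v a x₁ x₂ h₁₂ hDv, add_sub_add_comm]
  refine le_trans ?_ (add_le_add_right key _)
  have := abs_sub_abs_le_abs_sub (v x₂ (a + S.tauV x₂) - v' x₂ (a + S.tauV x₂))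
    (-((∫ ξ in x₁..x₂, S.fV (u ξ (a + S.tauV ξ), v ξ (a + S.tauV ξ)) ξ / S.lamV ξ) -
      ∫ ξ in x₁..x₂, S.fV (u' ξ (a + S.tauV ξ), v' ξ (a + S.tauV ξ)) ξ / S.lamV ξ))
  rw [abs_neg, sub_neg_eq_add] at this
  linarith

end Compare

/-! ### Uniqueness of the prediction -/

/-- Followed backwards in time, the `u`-characteristic through a point of `detU` reaches the initial
time or the boundary `x = 0`. -/
theorem exists_foot_u (hc : IsCoefficient S.fU S.lamU c C L) {t x s : ℝ}
    (hx : x ∈ Icc (0 : ℝ) 1) (hs : t ≤ s) : ∃ x₁ ∈ Icc 0 x,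
      t ≤ s - S.tauU x + S.tauU x₁ ∧ (x₁ = 0 ∨ s - S.tauU x + S.tauU x₁ = t) := by
  rcases le_or_gt t (s - S.tauU x + S.tauU 0) with h | h
  · exact ⟨0, ⟨le_rfl, hx.1⟩, h, Or.inl rfl⟩
  · have hcont : ContinuousOn (fun ξ => s - S.tauU x + S.tauU ξ) (Icc 0 x) :=
      continuousOn_const.add ((continuousOn_tauU hc).mono (Icc_subset_Icc le_rfl hx.2))
    obtain ⟨x₁, hx₁, he⟩ := intermediate_value_Icc hx.1 hcont (⟨h.le, by simpa using hs⟩ :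
      t ∈ Icc (s - S.tauU x + S.tauU 0) (s - S.tauU x + S.tauU x))
    exact ⟨x₁, hx₁, he.ge, Or.inr he⟩

/-- Followed backwards in time, the `v`-characteristic through a point of `detV` reaches the initial
time. -/
theorem exists_foot_v (hc : IsCoefficient S.fV S.lamV c C L) {t x s : ℝ}
    (hx : x ∈ Icc (0 : ℝ) 1) (hs : s ∈ Ico t (t + S.tauV x)) : ∃ x₂ ∈ Ico x 1,
      s - S.tauV x + S.tauV x₂ = t := by
  have hcont : ContinuousOn (fun ξ => s - S.tauV x + S.tauV ξ) (Icc x 1) :=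
    continuousOn_const.add ((continuousOn_tauV hc).mono (Icc_subset_Icc hx.1 le_rfl))
  obtain ⟨x₂, hx₂, he⟩ := intermediate_value_Icc' hx.2 hcont
    (⟨by simpa [tauV_one, sub_le_iff_le_add] using hs.2.le, by simpa using hs.1⟩ :
      t ∈ Icc (s - S.tauV x + S.tauV 1) (s - S.tauV x + S.tauV x))
  refine ⟨x₂, ⟨hx₂.1, hx₂.2.lt_of_ne ?_⟩, he⟩
  rintro rfl
  simp only [tauV_one] at he
  linarith [hs.2]

/-- Two predictions from the same state agree, except possibly for `u` at the corner
`(0, t + τᵛ(0))`, which lies outside `detV` and is not subject to any equation. The differences are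
measured with the weight `exp (κ C (s - t))`, for which one step of integration along
characteristics is a contraction if `κ` is large. -/
theorem IsPrediction.unique (hU : IsCoefficient S.fU S.lamU c C L)
    (hV : IsCoefficient S.fV S.lamV c C L) {G : ℝ≥0}
    (hG : ∀ t, 0 ≤ t → LipschitzWith G (fun y => S.g y t)) {t : ℝ} (ht : 0 ≤ t)
    {p q : ℝ → ℝ} {u v u' v' : ℝ → ℝ → ℝ} (h : S.IsPrediction t p q u v)
    (h' : S.IsPrediction t p q u' v') {x s : ℝ} (hx : x ∈ Icc (0 : ℝ) 1)
    (hs : s ∈ Icc t (t + S.tauV x)) (hcorner : 0 < x ∨ s < t + S.tauV x) : u x s = u' x s := by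
  have hC := hU.C_pos
  have hc := hU.c_pos
  have hL := hU.L_nonneg
  have hG0 : (0 : ℝ) ≤ G := G.2
  obtain ⟨κ, hκ, hκ2⟩ : ∃ κ : ℝ, 0 < κ ∧ L / c * (G + 1) ≤ κ / 2 :=
    ⟨2 * (L / c * (G + 1)) + 1, by positivity, by linarith⟩
  set W : ℝ → ℝ := fun s => Real.exp (κ * C * (s - t)) with hW
  have hWmono : ∀ s s', s ≤ s' → W s ≤ W s' := fun s s' hss => by
    simp only [hW]; gcongr
  have hWpos : ∀ s, 0 < W s := fun s => Real.exp_pos _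
  -- the weight decays along characteristics, since they are traversed in time at least `1 / C`
  have hWdecay : ∀ s s' d, d / C ≤ s - s' → W s' ≤ W s * Real.exp (-(κ * d)) := by
    intro s s' d hd
    simp only [hW, ← Real.exp_add]
    rw [div_le_iff₀ hC] at hd
    gcongr
    nlinarith
  -- the larger constant for `u` absorbs the Lipschitz constant `G` of the boundary condition
  let P : ℝ → Prop := fun B =>
    (∀ x ∈ Icc (0 : ℝ) 1, ∀ s ∈ Icc t (t + S.tauV x), (0 < x ∨ s < t + S.tauV x) →
      |u x s - u' x s| ≤ B * (G + 1) * W s) ∧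
    ∀ x ∈ Icc (0 : ℝ) 1, ∀ s ∈ Ico t (t + S.tauV x), |v x s - v' x s| ≤ B * W s
  have hstep : ∀ B, 0 ≤ B → P B → P (B / 2) := by
    intro B hB hP
    have hsmall : ∀ s, L / c * (B * (G + 1) * W s / κ) ≤ B / 2 * W s := by
      intro s
      calc L / c * (B * (G + 1) * W s / κ) = L / c * (G + 1) * (B * W s / κ) := by ring
        _ ≤ κ / 2 * (B * W s / κ) :=
          mul_le_mul_of_nonneg_right hκ2 (by have := hWpos s; positivity)
        _ = B / 2 * W s := by field_simp
    have hv : ∀ x ∈ Icc (0 : ℝ) 1, ∀ s ∈ Ico t (t + S.tauV x),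
        |v x s - v' x s| ≤ B / 2 * W s := by
      intro x hx s hs
      obtain ⟨x₂, hx₂, he⟩ := exists_foot_v hV hx hs
      set a := s - S.tauV x with ha
      have has : a + S.tauV x = s := by rw [ha]; ring
      have hmem : ∀ ξ ∈ Icc x x₂, ξ ∈ Icc (0 : ℝ) 1 ∧ a + S.tauV ξ ∈ Ico t (t + S.tauV ξ) := by
        intro ξ hξ
        have hb := (tauV_bounds hV (hx.1.trans hξ.1) hx₂.2.le hξ.2).1
        have : 0 ≤ (x₂ - ξ) / C := div_nonneg (sub_nonneg.2 hξ.2) hC.le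
        exact ⟨⟨hx.1.trans hξ.1, hξ.2.trans hx₂.2.le⟩, by linarith, by linarith [hs.2]⟩
      have key := h.broad.abs_sub_v_le h'.broad hV (a := a) hx.1 hx₂.2.le hx₂.1
        (fun ξ hξ => have hm := hmem ξ (Ioo_subset_Icc_self hξ); ⟨hm.1, hm.2.1, hm.2.2.le⟩)
        (fun ξ hξ => hmem ξ hξ) hκ
        (by have := hWpos s; positivity : 0 ≤ B * (G + 1) * W s) (fun ξ hξ => by
          have hm := hmem ξ (Ioo_subset_Icc_self hξ)
          have hd := hWdecay s (a + S.tauV ξ) (ξ - x)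
            (by linarith [(tauV_bounds hV hx.1 hm.1.2 hξ.1.le).1])
          have h1 := hP.1 ξ hm.1 _ ⟨hm.2.1, hm.2.2.le⟩ (Or.inr hm.2.2)
          have h2 := hP.2 ξ hm.1 _ hm.2
          have hBW : B * (G + 1) * W (a + S.tauV ξ) ≤
              B * (G + 1) * W s * Real.exp (-(κ * (ξ - x))) := by
            rw [mul_assoc _ (W s)]; gcongr
          refine ⟨h1.trans hBW, (h2.trans ?_).trans hBW⟩
          have := mul_nonneg (mul_nonneg hB hG0) (hWpos (a + S.tauV ξ)).le
          linarith)
      rw [has, he, h.init_v x₂ ⟨hx.1.trans hx₂.1, hx₂.2⟩,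
        h'.init_v x₂ ⟨hx.1.trans hx₂.1, hx₂.2⟩, sub_self, abs_zero, zero_add] at key
      exact key.trans (hsmall s)
    refine ⟨fun x hx s hs hcorner => ?_, hv⟩
    obtain ⟨x₁, hx₁, hfoot, hcase⟩ := exists_foot_u hU hx hs.1
    set a := s - S.tauU x with ha
    have has : a + S.tauU x = s := by rw [ha]; ring
    have hmem : ∀ ξ ∈ Icc x₁ x, ξ ∈ Icc (0 : ℝ) 1 ∧ t ≤ a + S.tauU ξ ∧
        a + S.tauU ξ + (x - ξ) / C ≤ s ∧ a + S.tauU ξ + (x - ξ) / C ≤ t + S.tauV ξ := by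
      intro ξ hξ
      have h0 := hx₁.1.trans hξ.1
      have hb := (tauU_bounds hU h0 hx.2 hξ.2).1
      have hb' := (tauU_bounds hU hx₁.1 (hξ.2.trans hx.2) hξ.1).1
      have hb'' := (tauV_bounds hV h0 hx.2 hξ.2).1
      have p1 : 0 ≤ (x - ξ) / C := div_nonneg (sub_nonneg.2 hξ.2) hC.le
      have p2 : 0 ≤ (ξ - x₁) / C := div_nonneg (sub_nonneg.2 hξ.1) hC.le
      exact ⟨⟨h0, hξ.2.trans hx.2⟩, by linarith, by linarith, by linarith [hs.2]⟩
    have hlt : ∀ ξ ∈ Icc x₁ x, ξ < x → a + S.tauU ξ < t + S.tauV ξ := by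
      intro ξ hξ hξx
      have : 0 < (x - ξ) / C := div_pos (sub_pos.2 hξx) hC
      linarith [(hmem ξ hξ).2.2.2]
    have hle : ∀ ξ ∈ Icc x₁ x, a + S.tauU ξ ≤ t + S.tauV ξ := by
      intro ξ hξ
      have : 0 ≤ (x - ξ) / C := div_nonneg (sub_nonneg.2 hξ.2) hC.le
      linarith [(hmem ξ hξ).2.2.2]
    have key := h.broad.abs_sub_u_le h'.broad hU (a := a) hx₁.1 hx.2 hx₁.2
      (fun ξ hξ => ⟨(hmem ξ hξ).1, (hmem ξ hξ).2.1, hle ξ hξ⟩)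
      (fun ξ hξ => have hξ' := Ioo_subset_Icc_self hξ
        ⟨(hmem ξ hξ').1, (hmem ξ hξ').2.1, hlt ξ hξ' hξ.2⟩) hκ
      (by have := hWpos s; positivity : 0 ≤ B * (G + 1) * W s) (fun ξ hξ => by
        have hξ' := Ioo_subset_Icc_self hξ
        have hm := hmem ξ hξ'
        have hd := hWdecay s (a + S.tauU ξ) (x - ξ) (by linarith [hm.2.2.1])
        have h1 := hP.1 ξ hm.1 _ ⟨hm.2.1, hle ξ hξ'⟩ (Or.inr (hlt ξ hξ' hξ.2))
        have h2 := hP.2 ξ hm.1 _ ⟨hm.2.1, hlt ξ hξ' hξ.2⟩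
        have hBW : B * (G + 1) * W (a + S.tauU ξ) ≤
            B * (G + 1) * W s * Real.exp (-(κ * (x - ξ))) := by
          rw [mul_assoc _ (W s)]; gcongr
        refine ⟨h1.trans hBW, (h2.trans ?_).trans hBW⟩
        have := mul_nonneg (mul_nonneg hB hG0) (hWpos (a + S.tauU ξ)).le
        linarith)
    rw [has] at key
    have hx₁mem : x₁ ∈ Icc x₁ x := ⟨le_rfl, hx₁.2⟩
    have hm₁ := hmem x₁ hx₁mem
    -- at a foot on the boundary the bound for `v`, already halved, is used
    have hinit : |u x₁ (a + S.tauU x₁) - u' x₁ (a + S.tauU x₁)| ≤ G * (B / 2 * W s) := by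
      rcases hx₁.1.eq_or_lt with h0 | h0
      · subst h0
        have hmV : a + S.tauU 0 < t + S.tauV 0 := by
          rcases hx.1.eq_or_lt with h0 | h0
          · subst h0
            rw [has]
            exact hcorner.resolve_left (lt_irrefl _)
          · exact hlt 0 hx₁mem h0
        have hmu : ((0 : ℝ), a + S.tauU 0) ∈ S.detU t := ⟨hm₁.1, hm₁.2.1, hmV.le⟩
        have hmv : ((0 : ℝ), a + S.tauU 0) ∈ S.detV t := ⟨hm₁.1, hm₁.2.1, hmV⟩
        rw [h.broad.bc_zero _ hmu hmv, h'.broad.bc_zero _ hmu hmv, ← Real.dist_eq]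
        refine ((hG _ (ht.trans hm₁.2.1)).dist_le_mul _ _).trans
          (mul_le_mul_of_nonneg_left ?_ hG0)
        rw [Real.dist_eq]
        refine (hv 0 hm₁.1 _ hmv.2).trans (mul_le_mul_of_nonneg_left (hWmono _ _ ?_) (by positivity))
        have : 0 ≤ (x - 0) / C := div_nonneg (sub_nonneg.2 hx.1) hC.le
        linarith [hm₁.2.2.1]
      · rw [hcase.resolve_left h0.ne', h.init_u x₁ ⟨h0, hm₁.1.2⟩, h'.init_u x₁ ⟨h0, hm₁.1.2⟩,
          sub_self, abs_zero]
        have := hWpos s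
        positivity
    have := hsmall s
    linarith
  obtain ⟨M, hM⟩ := h.broad.bdd_u (t + S.tauV 0)
  obtain ⟨M', hM'⟩ := h'.broad.bdd_u (t + S.tauV 0)
  obtain ⟨N, hN⟩ := h.broad.bdd_v (t + S.tauV 0)
  obtain ⟨N', hN'⟩ := h'.broad.bdd_v (t + S.tauV 0)
  have htime : ∀ x ∈ Icc (0 : ℝ) 1, S.tauV x ≤ S.tauV 0 := by
    intro x hx
    have := (tauV_bounds hV le_rfl hx.2 hx.1).1
    have : 0 ≤ (x - 0) / C := div_nonneg (sub_nonneg.2 hx.1) hC.le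
    linarith
  have hW1 : ∀ s, t ≤ s → 1 ≤ W s := fun s hs =>
    Real.one_le_exp (mul_nonneg (by positivity) (sub_nonneg.2 hs))
  set B := |M| + |M'| + |N| + |N'| with hB
  have hB0 : 0 ≤ B := by positivity
  have hP : P B := by
    refine ⟨fun x hx s hs _ => ?_, fun x hx s hs => ?_⟩
    · have h1 := hM (x, s) ⟨hx, hs⟩ (by have := htime x hx; have := hs.2; simp only; linarith)
      have h2 := hM' (x, s) ⟨hx, hs⟩ (by have := htime x hx; have := hs.2; simp only; linarith)
      have h3 : |u x s - u' x s| ≤ B := (abs_sub _ _).trans (by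
        linarith [le_abs_self M, le_abs_self M', abs_nonneg N, abs_nonneg N'])
      have h4 : B * 1 ≤ B * ((G + 1) * W s) := mul_le_mul_of_nonneg_left
        (one_le_mul_of_one_le_of_one_le (by linarith) (hW1 s hs.1)) hB0
      linarith
    · have h1 := hN (x, s) ⟨hx, hs⟩ (by have := htime x hx; have := hs.2; simp only; linarith)
      have h2 := hN' (x, s) ⟨hx, hs⟩ (by have := htime x hx; have := hs.2; simp only; linarith)
      have h3 : |v x s - v' x s| ≤ B := (abs_sub _ _).trans (by
        linarith [le_abs_self N, le_abs_self N', abs_nonneg M, abs_nonneg M'])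
      have h4 : B * 1 ≤ B * W s := mul_le_mul_of_nonneg_left (hW1 s hs.1) hB0
      linarith
  refine sub_eq_zero.1 (eq_zero_of_le_div_two_pow (B := B) (W := (G + 1) * W s) fun n => ?_)
  rw [← mul_assoc]
  exact (bound_div_two_pow hstep hB0 hP n).1 x hx s hs hcorner

end HypSystem

/-! ### The target equation -/

theorem IsTame.mono {w : ℝ → ℝ × ℝ} {x₁ x₂ y₁ y₂ : ℝ} (h : IsTame w x₁ x₂) (h₁ : x₁ ≤ y₁)
    (h₂ : y₂ ≤ x₂) : IsTame w y₁ y₂ :=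
  ⟨h.1.mono_measure (Measure.restrict_mono_set _ (Ioo_subset_Ioo h₁ h₂)),
    h.2.imp fun _ hM ξ hξ => hM ξ (Ioo_subset_Ioo h₁ h₂ hξ)⟩

theorem isTame_prodMk {a y : ℝ → ℝ} (ha : AEMeasurable a (volume.restrict (Ioo 0 1)))
    {M : ℝ} (hM : ∀ ξ ∈ Ioo (0 : ℝ) 1, |a ξ| ≤ M) (hy : ContinuousOn y (Icc 0 1)) :
    IsTame (fun ξ => (a ξ, y ξ)) 0 1 := by
  obtain ⟨N, hN⟩ := isCompact_Icc.exists_bound_of_continuousOn hy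
  exact ⟨ha.prodMk ((hy.mono Ioo_subset_Icc_self).aemeasurable measurableSet_Ioo),
    max M N, fun ξ hξ => max_le_max (hM ξ hξ) (hN ξ (Ioo_subset_Icc_self hξ))⟩

namespace IsCoefficient

variable {f : ℝ × ℝ → ℝ → ℝ} {lam : ℝ → ℝ} {c C L : ℝ} {a y z : ℝ → ℝ}

/-- Uniqueness for the target equation with data at `x = 0`. -/
theorem eq_of_forward (h : IsCoefficient f lam c C L) (hy : IsTame (fun ξ => (a ξ, y ξ)) 0 1)
    (hz : IsTame (fun ξ => (a ξ, z ξ)) 0 1) {M : ℝ} (hM : ∀ x ∈ Icc (0 : ℝ) 1, |y x - z x| ≤ M)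
    (heq : ∀ x ∈ Icc (0 : ℝ) 1, y x - z x = -((∫ ξ in (0 : ℝ)..x, f (a ξ, y ξ) ξ / lam ξ) -
      ∫ ξ in (0 : ℝ)..x, f (a ξ, z ξ) ξ / lam ξ)) {x : ℝ} (hx : x ∈ Icc (0 : ℝ) 1) :
    y x = z x := by
  have hc := h.c_pos
  have hL := h.L_nonneg
  obtain ⟨κ, hκ, hκ2⟩ : ∃ κ : ℝ, 0 < κ ∧ L / c ≤ κ / 2 :=
    ⟨2 * (L / c) + 1, by positivity, by linarith⟩
  let P : ℝ → Prop := fun B => ∀ x ∈ Icc (0 : ℝ) 1, |y x - z x| ≤ B * Real.exp (κ * x)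
  have hstep : ∀ B, 0 ≤ B → P B → P (B / 2) := by
    intro B hB hP x hx
    rw [heq x hx, abs_neg]
    refine (h.abs_integral_sub_le_left le_rfl hx.2 hx.1 (hy.mono le_rfl hx.2)
      (hz.mono le_rfl hx.2) hκ (by positivity : 0 ≤ B * Real.exp (κ * x)) fun ξ hξ => ?_).trans ?_
    · rw [mul_assoc, ← Real.exp_add]
      have h1 := hP ξ ⟨hξ.1.le, hξ.2.le.trans hx.2⟩
      rw [show κ * x + -(κ * (x - ξ)) = κ * ξ by ring]
      simp only [Prod.mk_sub_mk, sub_self, Prod.norm_mk, norm_zero, Real.norm_eq_abs]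
      exact max_le (by positivity) h1
    · calc _ ≤ κ / 2 * (B * Real.exp (κ * x) / κ) :=
            mul_le_mul_of_nonneg_right hκ2 (by positivity)
        _ = B / 2 * Real.exp (κ * x) := by field_simp
  have hM0 : 0 ≤ M := (abs_nonneg _).trans (hM 0 ⟨le_rfl, zero_le_one⟩)
  have hP : P M := fun x hx => (hM x hx).trans
    (le_mul_of_one_le_right hM0 (Real.one_le_exp (mul_nonneg hκ.le hx.1)))
  exact sub_eq_zero.1 (eq_zero_of_le_div_two_pow fun n => bound_div_two_pow hstep hM0 hP n x hx)

/-- Uniqueness for the target equation with data at `x = 1`. -/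
theorem eq_of_backward (h : IsCoefficient f lam c C L) (hy : IsTame (fun ξ => (a ξ, y ξ)) 0 1)
    (hz : IsTame (fun ξ => (a ξ, z ξ)) 0 1) {M : ℝ} (hM : ∀ x ∈ Icc (0 : ℝ) 1, |y x - z x| ≤ M)
    (heq : ∀ x ∈ Icc (0 : ℝ) 1, y x - z x = (∫ ξ in x..1, f (a ξ, y ξ) ξ / lam ξ) -
      ∫ ξ in x..1, f (a ξ, z ξ) ξ / lam ξ) {x : ℝ} (hx : x ∈ Icc (0 : ℝ) 1) :
    y x = z x := by
  have hc := h.c_pos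
  have hL := h.L_nonneg
  obtain ⟨κ, hκ, hκ2⟩ : ∃ κ : ℝ, 0 < κ ∧ L / c ≤ κ / 2 :=
    ⟨2 * (L / c) + 1, by positivity, by linarith⟩
  let P : ℝ → Prop := fun B => ∀ x ∈ Icc (0 : ℝ) 1, |y x - z x| ≤ B * Real.exp (κ * (1 - x))
  have hstep : ∀ B, 0 ≤ B → P B → P (B / 2) := by
    intro B hB hP x hx
    rw [heq x hx]
    refine (h.abs_integral_sub_le_right hx.1 le_rfl hx.2 (hy.mono hx.1 le_rfl)
      (hz.mono hx.1 le_rfl) hκ (by positivity : 0 ≤ B * Real.exp (κ * (1 - x)))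
      fun ξ hξ => ?_).trans ?_
    · rw [mul_assoc, ← Real.exp_add]
      have h1 := hP ξ ⟨hx.1.trans hξ.1.le, hξ.2.le⟩
      rw [show κ * (1 - x) + -(κ * (ξ - x)) = κ * (1 - ξ) by ring]
      simp only [Prod.mk_sub_mk, sub_self, Prod.norm_mk, norm_zero, Real.norm_eq_abs]
      exact max_le (by positivity) h1
    · calc _ ≤ κ / 2 * (B * Real.exp (κ * (1 - x)) / κ) :=
            mul_le_mul_of_nonneg_right hκ2 (by positivity)
        _ = B / 2 * Real.exp (κ * (1 - x)) := by field_simp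
  have hM0 : 0 ≤ M := (abs_nonneg _).trans (hM 0 ⟨le_rfl, zero_le_one⟩)
  have hP : P M := fun x hx => (hM x hx).trans
    (le_mul_of_one_le_right hM0 (Real.one_le_exp (mul_nonneg hκ.le (sub_nonneg.2 hx.2))))
  exact sub_eq_zero.1 (eq_zero_of_le_div_two_pow fun n => bound_div_two_pow hstep hM0 hP n x hx)

/-- Existence for the target equation: after the substitution `y = exp (κ x) z`, the Picard operator
is a contraction of `C([0,1])`. -/
theorem exists_target (h : IsCoefficient f lam c C L)
    (ha : AEMeasurable a (volume.restrict (Ioo 0 1))) {M : ℝ}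
    (hM : ∀ ξ ∈ Ioo (0 : ℝ) 1, |a ξ| ≤ M) :
    ∃ y : ℝ → ℝ, ContinuousOn y (Icc 0 1) ∧
      ∀ x ∈ Icc (0 : ℝ) 1, y x = -∫ ξ in (0 : ℝ)..x, f (a ξ, y ξ) ξ / lam ξ := by
  have hc := h.c_pos
  have hL := h.L_nonneg
  obtain ⟨κ, hκ, hκ2⟩ : ∃ κ : ℝ, 0 < κ ∧ L / c ≤ κ / 2 :=
    ⟨2 * (L / c) + 1, by positivity, by linarith⟩
  let Y : C(Icc (0 : ℝ) 1, ℝ) → ℝ → ℝ := fun z ξ =>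
    Real.exp (κ * ξ) * IccExtend zero_le_one z ξ
  have hYc : ∀ z, Continuous (Y z) := fun z =>
    (by fun_prop : Continuous fun ξ : ℝ => Real.exp (κ * ξ)).mul z.continuous.Icc_extend'
  have htame : ∀ z, IsTame (fun ξ => (a ξ, Y z ξ)) 0 1 := fun z =>
    isTame_prodMk ha hM (hYc z).continuousOn
  let Φ : C(Icc (0 : ℝ) 1, ℝ) → ℝ → ℝ := fun z x =>
    -∫ ξ in (0 : ℝ)..x, f (a ξ, Y z ξ) ξ / lam ξ
  have hΦ : ∀ z, ContinuousOn (Φ z) (Icc 0 1) := by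
    intro z
    have hi := h.intervalIntegrable_comp le_rfl le_rfl zero_le_one (htame z)
    have := intervalIntegral.continuousOn_primitive_interval' hi left_mem_uIcc
    rw [uIcc_of_le zero_le_one] at this
    exact this.neg
  let T : C(Icc (0 : ℝ) 1, ℝ) → C(Icc (0 : ℝ) 1, ℝ) := fun z =>
    ⟨fun x => Real.exp (-(κ * x)) * Φ z x,
      (by fun_prop : Continuous fun x : Icc (0 : ℝ) 1 => Real.exp (-(κ * x))).mul
        (continuousOn_iff_continuous_domRestrict.1 (hΦ z))⟩
  have hT : ContractingWith (1 / 2) T := by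
    refine ⟨by norm_num, LipschitzWith.of_dist_le_mul fun z z' => ?_⟩
    rw [ContinuousMap.dist_le (by positivity)]
    intro x
    have hx := x.2
    have hd := h.abs_integral_sub_le_left le_rfl hx.2 hx.1 ((htame z).mono le_rfl hx.2)
      ((htame z').mono le_rfl hx.2) hκ
      (by positivity : 0 ≤ dist z z' * Real.exp (κ * x)) fun ξ hξ => by
        rw [mul_assoc, ← Real.exp_add, show κ * (x : ℝ) + -(κ * (x - ξ)) = κ * ξ by ring]
        simp only [Prod.mk_sub_mk, sub_self, Prod.norm_mk, norm_zero, Real.norm_eq_abs]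
        refine max_le (by positivity) ?_
        simp only [Y, ← mul_sub]
        rw [abs_mul, Real.abs_exp, mul_comm]
        exact mul_le_mul_of_nonneg_right
          (ContinuousMap.dist_apply_le_dist (f := z) (g := z') _) (Real.exp_pos _).le
    have hexp : Real.exp (-(κ * x)) * Real.exp (κ * x) = 1 := by
      rw [← Real.exp_add]; simp
    rw [Real.dist_eq]
    calc |T z x - T z' x| = Real.exp (-(κ * x)) *
          |(∫ ξ in (0 : ℝ)..x, f (a ξ, Y z ξ) ξ / lam ξ) -
            ∫ ξ in (0 : ℝ)..x, f (a ξ, Y z' ξ) ξ / lam ξ| := by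
          simp only [T, Φ, ContinuousMap.coe_mk, ← mul_sub]
          rw [abs_mul, Real.abs_exp, neg_sub_neg, abs_sub_comm]
      _ ≤ Real.exp (-(κ * x)) * (κ / 2 * (dist z z' * Real.exp (κ * x) / κ)) := by
          gcongr
          exact hd.trans (mul_le_mul_of_nonneg_right hκ2 (by positivity))
      _ = (Real.exp (-(κ * x)) * Real.exp (κ * x)) * (1 / 2 * dist z z') := by
          field_simp
      _ = ((1 / 2 : ℝ≥0) : ℝ) * dist z z' := by rw [hexp, one_mul]; simp
  have hfix := hT.fixedPoint_isFixedPt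
  set z := ContractingWith.fixedPoint T hT
  refine ⟨Y z, (hYc z).continuousOn, fun x hx => ?_⟩
  have hz : z ⟨x, hx⟩ = Real.exp (-(κ * x)) * Φ z x :=
    (DFunLike.congr_fun hfix.eq ⟨x, hx⟩).symm
  change Real.exp (κ * x) * IccExtend zero_le_one z x = Φ z x
  rw [IccExtend_of_mem _ _ hx, hz, ← mul_assoc, ← Real.exp_add]
  simp

end IsCoefficient

namespace HypSystem

variable {S : HypSystem} {c C L : ℝ}

/-- The value of the predicted `u` at `x = 0`, which a prediction leaves undetermined, does not
matter. -/
theorem IsTarget.congr {a a' y : ℝ → ℝ} (h : S.IsTarget a y) (haa' : EqOn a a' (Ioc 0 1)) :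
    S.IsTarget a' y := by
  refine ⟨h.cont, fun x hx => ?_⟩
  rw [h.eq x hx]
  congr 1
  refine intervalIntegral.integral_congr_uIoo fun ξ hξ => ?_
  rw [uIoo_of_le hx.1] at hξ
  simp only [haa' ⟨hξ.1, hξ.2.le.trans hx.2⟩]

theorem IsTarget.unique (hV : IsCoefficient S.fV S.lamV c C L) {a y y' : ℝ → ℝ}
    (ha : AEMeasurable a (volume.restrict (Ioo 0 1))) {M : ℝ}
    (hM : ∀ ξ ∈ Ioo (0 : ℝ) 1, |a ξ| ≤ M) (h : S.IsTarget a y) (h' : S.IsTarget a y') :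
    EqOn y y' (Icc 0 1) := by
  obtain ⟨N, hN⟩ := isCompact_Icc.exists_bound_of_continuousOn (h.cont.sub h'.cont)
  intro x hx
  refine hV.eq_of_forward (isTame_prodMk ha hM h.cont) (isTame_prodMk ha hM h'.cont) hN
    (fun x hx => ?_) hx
  rw [h.eq x hx, h'.eq x hx]
  ring

end HypSystem

namespace HypSystem

variable {S : HypSystem} {c C L : ℝ} {u v : ℝ → ℝ → ℝ}

/-! ### The closed loop -/

theorem IsBroadSolution.mono {Du Dv Du' Dv' : Set (ℝ × ℝ)} (h : S.IsBroadSolution Du Dv u v)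
    (hu : Du' ⊆ Du) (hv : Dv' ⊆ Dv) : S.IsBroadSolution Du' Dv' u v where
  meas_u := h.meas_u.comp (measurable_inclusion hu)
  meas_v := h.meas_v.comp (measurable_inclusion hv)
  bdd_u T := (h.bdd_u T).imp fun _ hM p hp => hM p (hu hp)
  bdd_v T := (h.bdd_v T).imp fun _ hM p hp => hM p (hv hp)
  eq_u a x₁ x₂ h₁₂ hD := h.eq_u a x₁ x₂ h₁₂ fun ξ hξ => hu (hD ξ hξ)
  eq_v a x₁ x₂ h₁₂ hD := h.eq_v a x₁ x₂ h₁₂ fun ξ hξ => hv (hD ξ hξ)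
  bc_zero s h₁ h₂ := h.bc_zero s (hu h₁) (hv h₂)

theorem Admissible.isBroadSolution_zero (hS : S.Admissible) :
    S.IsBroadSolution strip strip (fun _ _ => 0) (fun _ _ => 0) where
  meas_u := measurable_const
  meas_v := measurable_const
  bdd_u _ := ⟨0, by simp⟩
  bdd_v _ := ⟨0, by simp⟩
  eq_u a x₁ x₂ h₁₂ hD := by
    rw [intervalIntegral.integral_congr (g := fun _ => 0), intervalIntegral.integral_zero, add_zero]
    intro ξ hξ
    rw [uIcc_of_le h₁₂] at hξ
    have := (hS.f_zero ξ (hD ξ hξ).1).1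
    simp [Prod.mk_zero_zero, this]
  eq_v a x₁ x₂ h₁₂ hD := by
    rw [intervalIntegral.integral_congr (g := fun _ => 0), intervalIntegral.integral_zero, add_zero]
    intro ξ hξ
    rw [uIcc_of_le h₁₂] at hξ
    have := (hS.f_zero ξ (hD ξ hξ).1).2
    simp [Prod.mk_zero_zero, this]
  bc_zero s hs _ := (hS.g_zero s hs.2).symm

theorem tauV_nonneg (hV : IsCoefficient S.fV S.lamV c C L) {x : ℝ} (hx : x ∈ Icc (0 : ℝ) 1) :
    0 ≤ S.tauV x := by
  have := (tauV_bounds hV hx.1 le_rfl hx.2).1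
  rw [tauV_one, sub_zero] at this
  exact (div_nonneg (sub_nonneg.2 hx.2) hV.C_pos.le).trans this

theorem tauU_nonneg (hU : IsCoefficient S.fU S.lamU c C L) {x : ℝ} (hx : x ∈ Icc (0 : ℝ) 1) :
    0 ≤ S.tauU x := by
  have := (tauU_bounds hU le_rfl hx.2 hx.1).1
  rw [tauU_zero, sub_zero, sub_zero] at this
  exact (div_nonneg hx.1 hU.C_pos.le).trans this

/-- The solution itself, restricted to the determinate sets, is a prediction. -/
theorem IsBroadSolution.isPrediction (h : S.IsBroadSolution strip strip u v) {t : ℝ} (ht : 0 ≤ t) :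
    S.IsPrediction t (fun x => u x t) (fun x => v x t) u v :=
  ⟨h.mono (fun _ hp => ⟨hp.1, ht.trans hp.2.1⟩) (fun _ hp => ⟨hp.1, ht.trans hp.2.1⟩),
    fun _ _ => rfl, fun _ _ => rfl⟩

/-- The state along the `v`-characteristic that starts at `(1, t)`. -/
theorem IsBroadSolution.isTame_vChar (hV : IsCoefficient S.fV S.lamV c C L)
    (h : S.IsBroadSolution strip strip u v) {t : ℝ} (ht : 0 ≤ t) :
    IsTame (fun ξ => (u ξ (t + S.tauV ξ), v ξ (t + S.tauV ξ))) 0 1 := by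
  have hmem : ∀ ξ ∈ Ioo (0 : ℝ) 1, (ξ, t + S.tauV ξ) ∈ strip := fun ξ hξ =>
    ⟨Ioo_subset_Icc_self hξ, add_nonneg ht (tauV_nonneg hV (Ioo_subset_Icc_self hξ))⟩
  exact h.isTame (continuousOn_tauV hV) le_rfl le_rfl hmem hmem

/-- The target of every feedback computation uses the values of the actual solution. -/
theorem IsFeedbackValue.exists_target (hS : S.Admissible)
    (h : S.IsBroadSolution strip strip u v) {t a : ℝ} (ht : 0 ≤ t)
    (ha : S.IsFeedbackValue t (fun x => u x t) (fun x => v x t) a) :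
    ∃ y, S.IsTarget (fun x => u x (t + S.tauV x)) y ∧ a = y 1 := by
  obtain ⟨c, C, L, hU, hV⟩ := hS.exists_isCoefficient
  obtain ⟨G, hG⟩ := hS.g_lipschitz
  obtain ⟨u', v', y, hp, hy, rfl⟩ := ha
  refine ⟨y, hy.congr fun x hx => ?_, rfl⟩
  have hx' := Ioc_subset_Icc_self hx
  exact hp.unique hU hV hG ht (h.isPrediction ht) hx'
    ⟨le_add_of_nonneg_right (tauV_nonneg hV hx'), le_rfl⟩ (Or.inl hx.1)

theorem IsBroadSolution.existsUnique_feedback (hS : S.Admissible)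
    (h : S.IsBroadSolution strip strip u v) {t : ℝ} (ht : 0 ≤ t) :
    ∃! a, S.IsFeedbackValue t (fun x => u x t) (fun x => v x t) a := by
  obtain ⟨c, C, L, hU, hV⟩ := hS.exists_isCoefficient
  have htame := h.isTame_vChar hV ht
  obtain ⟨M, hM⟩ := htame.2
  have hM' : ∀ ξ ∈ Ioo (0 : ℝ) 1, |u ξ (t + S.tauV ξ)| ≤ M := fun ξ hξ =>
    (norm_fst_le _).trans (hM ξ hξ)
  have hm := htame.1.fst
  obtain ⟨y, hyc, hy⟩ := hV.exists_target hm hM'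
  refine ⟨y 1, ⟨u, v, y, h.isPrediction ht, ⟨hyc, hy⟩, rfl⟩, fun a ha => ?_⟩
  obtain ⟨y', hy', rfl⟩ := ha.exists_target hS h ht
  exact hy'.unique hV hm hM' ⟨hyc, hy⟩ ⟨zero_le_one, le_rfl⟩

/-- If the feedback value is applied at time `t`, then `v` vanishes where the `v`-characteristic
from `(1, t)` meets the boundary `x = 0`: along this characteristic `v` solves the target
equation. -/
theorem IsBroadSolution.v_zero_of_feedback (hS : S.Admissible)
    (h : S.IsBroadSolution strip strip u v) {t : ℝ} (ht : 0 ≤ t)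
    (ha : S.IsFeedbackValue t (fun x => u x t) (fun x => v x t) (v 1 t)) :
    v 0 (t + S.tauV 0) = 0 := by
  obtain ⟨c, C, L, hU, hV⟩ := hS.exists_isCoefficient
  obtain ⟨y, hy, hy1⟩ := ha.exists_target hS h ht
  have htame := h.isTame_vChar hV ht
  obtain ⟨M, hM⟩ := htame.2
  have htame' := isTame_prodMk htame.1.fst (fun ξ hξ => (norm_fst_le _).trans (hM ξ hξ)) hy.cont
  obtain ⟨N, hN⟩ := isCompact_Icc.exists_bound_of_continuousOn hy.cont
  obtain ⟨N', hN'⟩ := h.bdd_v (t + S.tauV 0)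
  have hmem : ∀ ξ ∈ Icc (0 : ℝ) 1, (ξ, t + S.tauV ξ) ∈ strip := fun ξ hξ =>
    ⟨hξ, add_nonneg ht (tauV_nonneg hV hξ)⟩
  have key := hV.eq_of_backward htame htame' (M := N' + N) (fun x hx => ?_) (fun x hx => ?_)
    (left_mem_Icc.2 zero_le_one)
  · rw [key, hy.eq 0 (left_mem_Icc.2 zero_le_one), intervalIntegral.integral_same, neg_zero]
  · refine (abs_sub _ _).trans (add_le_add (hN' _ (hmem x hx) ?_) (hN x hx))
    have := (tauV_bounds hV le_rfl hx.2 hx.1).1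
    have : 0 ≤ (x - 0) / C := div_nonneg (sub_nonneg.2 hx.1) hV.C_pos.le
    simp only
    linarith
  · have h1 := h.eq_v t x 1 hx.2 fun ξ hξ => hmem ξ ⟨hx.1.trans hξ.1, hξ.2⟩
    rw [tauV_one, add_zero, hy1, hy.eq 1 (right_mem_Icc.2 zero_le_one)] at h1
    have hi := hV.intervalIntegrable_comp le_rfl hx.2 hx.1 (htame'.mono le_rfl hx.2)
    have hi' := hV.intervalIntegrable_comp hx.1 le_rfl hx.2 (htame'.mono hx.1 le_rfl)
    rw [h1, hy.eq x hx, ← intervalIntegral.integral_add_adjacent_intervals hi hi']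
    ring

/-- If `v` vanishes on the boundary `x = 0` from time `τᵛ(0)` on, then the state vanishes from time
`τᵛ(0) + τᵘ(1)` on. Here `x` is the evolution variable: the trapezoid
`τᵛ(0) + τᵘ(x) ≤ s ≤ t + τᵛ(x)` contains the parts over `[0, x]` of both characteristics through
each of its points. -/
theorem IsBroadSolution.eq_zero_of_v_zero (hS : S.Admissible)
    (h : S.IsBroadSolution strip strip u v) (hv0 : ∀ s, S.tauV 0 ≤ s → v 0 s = 0) {t : ℝ}
    (ht : S.tauV 0 + S.tauU 1 ≤ t) {x : ℝ} (hx : x ∈ Icc (0 : ℝ) 1) :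
    u x t = 0 ∧ v x t = 0 := by
  obtain ⟨c, C, L, hU, hV⟩ := hS.exists_isCoefficient
  have hc := hU.c_pos
  have hC := hU.C_pos
  have hL := hU.L_nonneg
  have h0V := tauV_nonneg hV (left_mem_Icc.2 zero_le_one)
  have hu0 : ∀ s, S.tauV 0 ≤ s → u 0 s = 0 := fun s hs => by
    have hm : ((0 : ℝ), s) ∈ strip := ⟨left_mem_Icc.2 zero_le_one, h0V.trans hs⟩
    rw [h.bc_zero s hm hm, hv0 s hs, hS.g_zero s (h0V.trans hs)]
  obtain ⟨κ, hκ, hκ2⟩ : ∃ κ : ℝ, 0 < κ ∧ L / c ≤ κ / 2 :=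
    ⟨2 * (L / c) + 1, by positivity, by linarith⟩
  have hmonoU : ∀ ξ x, 0 ≤ ξ → x ≤ 1 → ξ ≤ x → S.tauU ξ ≤ S.tauU x := fun ξ x h₁ h₂ h₁₂ => by
    have := (tauU_bounds hU h₁ h₂ h₁₂).1
    have : 0 ≤ (x - ξ) / C := div_nonneg (sub_nonneg.2 h₁₂) hC.le
    linarith
  have hmonoV : ∀ ξ x, 0 ≤ ξ → x ≤ 1 → ξ ≤ x → S.tauV x ≤ S.tauV ξ := fun ξ x h₁ h₂ h₁₂ => by
    have := (tauV_bounds hV h₁ h₂ h₁₂).1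
    have : 0 ≤ (x - ξ) / C := div_nonneg (sub_nonneg.2 h₁₂) hC.le
    linarith
  let P : ℝ → Prop := fun B => ∀ x ∈ Icc (0 : ℝ) 1, ∀ s, S.tauV 0 + S.tauU x ≤ s →
    s ≤ t + S.tauV x → |u x s| ≤ B * Real.exp (κ * x) ∧ |v x s| ≤ B * Real.exp (κ * x)
  have hz := hS.isBroadSolution_zero
  have hstep : ∀ B, 0 ≤ B → P B → P (B / 2) := by
    intro B hB hP x hx s hs1 hs2
    have hsmall : L / c * (B * Real.exp (κ * x) / κ) ≤ B / 2 * Real.exp (κ * x) :=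
      calc L / c * (B * Real.exp (κ * x) / κ) ≤ κ / 2 * (B * Real.exp (κ * x) / κ) :=
            mul_le_mul_of_nonneg_right hκ2 (by positivity)
        _ = B / 2 * Real.exp (κ * x) := by field_simp
    have hdecay : ∀ ξ, B * Real.exp (κ * ξ) = B * Real.exp (κ * x) * Real.exp (-(κ * (x - ξ))) :=
      fun ξ => by rw [mul_assoc, ← Real.exp_add]; ring_nf
    constructor
    · have hreg : ∀ ξ ∈ Icc 0 x, ξ ∈ Icc (0 : ℝ) 1 ∧
          S.tauV 0 + S.tauU ξ ≤ s - S.tauU x + S.tauU ξ ∧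
          s - S.tauU x + S.tauU ξ ≤ t + S.tauV ξ := fun ξ hξ => by
        have h1 := hmonoU ξ x hξ.1 hx.2 hξ.2
        have h2 := hmonoV ξ x hξ.1 hx.2 hξ.2
        exact ⟨⟨hξ.1, hξ.2.trans hx.2⟩, by linarith, by linarith⟩
      have hstrip : ∀ ξ ∈ Icc 0 x, (ξ, s - S.tauU x + S.tauU ξ) ∈ strip := fun ξ hξ =>
        ⟨(hreg ξ hξ).1, by
          have := (hreg ξ hξ).2.1
          have := tauU_nonneg hU (hreg ξ hξ).1
          simp only
          linarith⟩
      have key := h.abs_sub_u_le hz hU le_rfl hx.2 hx.1 hstrip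
        (fun ξ hξ => hstrip ξ (Ioo_subset_Icc_self hξ)) hκ
        (by positivity : 0 ≤ B * Real.exp (κ * x)) fun ξ hξ => by
          have hr := hreg ξ (Ioo_subset_Icc_self hξ)
          have := hP ξ hr.1 _ hr.2.1 hr.2.2
          rwa [hdecay, ← sub_zero (u _ _), ← sub_zero (v _ _)] at this
      rw [hu0 (s - S.tauU x + S.tauU 0) (by rw [tauU_zero]; linarith)] at key
      simp only [sub_add_cancel, sub_zero, abs_zero, zero_add] at key
      exact key.trans hsmall
    · have hreg : ∀ ξ ∈ Icc 0 x, ξ ∈ Icc (0 : ℝ) 1 ∧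
          S.tauV 0 + S.tauU ξ ≤ s - S.tauV x + S.tauV ξ ∧
          s - S.tauV x + S.tauV ξ ≤ t + S.tauV ξ := fun ξ hξ => by
        have h1 := hmonoU ξ x hξ.1 hx.2 hξ.2
        have h2 := hmonoV ξ x hξ.1 hx.2 hξ.2
        exact ⟨⟨hξ.1, hξ.2.trans hx.2⟩, by linarith, by linarith⟩
      have hstrip : ∀ ξ ∈ Icc 0 x, (ξ, s - S.tauV x + S.tauV ξ) ∈ strip := fun ξ hξ =>
        ⟨(hreg ξ hξ).1, by
          have := (hreg ξ hξ).2.1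
          have := tauU_nonneg hU (hreg ξ hξ).1
          simp only
          linarith⟩
      have key := h.abs_sub_v_le' hz hV le_rfl hx.2 hx.1
        (fun ξ hξ => hstrip ξ (Ioo_subset_Icc_self hξ)) hstrip hκ
        (by positivity : 0 ≤ B * Real.exp (κ * x)) fun ξ hξ => by
          have hr := hreg ξ (Ioo_subset_Icc_self hξ)
          have := hP ξ hr.1 _ hr.2.1 hr.2.2
          rwa [hdecay, ← sub_zero (u _ _), ← sub_zero (v _ _)] at this
      rw [hv0 (s - S.tauV x + S.tauV 0) (by
        have := tauU_nonneg hU hx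
        have := hmonoV 0 x le_rfl hx.2 hx.1
        linarith)] at key
      simp only [sub_add_cancel, sub_zero, abs_zero, zero_add] at key
      exact key.trans hsmall
  obtain ⟨M, hM⟩ := h.bdd_u (t + S.tauV 0)
  obtain ⟨N, hN⟩ := h.bdd_v (t + S.tauV 0)
  have hB0 : 0 ≤ |M| + |N| := by positivity
  have hP : P (|M| + |N|) := by
    intro x hx s hs1 hs2
    have hm : (x, s) ∈ strip := ⟨hx, by have := tauU_nonneg hU hx; simp only; linarith⟩
    have hs3 : s ≤ t + S.tauV 0 := by linarith [hmonoV 0 x le_rfl hx.2 hx.1]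
    have h1 : |M| + |N| ≤ (|M| + |N|) * Real.exp (κ * x) :=
      le_mul_of_one_le_right hB0 (Real.one_le_exp (mul_nonneg hκ.le hx.1))
    have h2 := hM _ hm hs3
    have h3 := hN _ hm hs3
    exact ⟨by linarith [le_abs_self M, abs_nonneg N], by linarith [le_abs_self N, abs_nonneg M]⟩
  have hfin := fun n => bound_div_two_pow hstep hB0 hP n x hx t
    (by linarith [hmonoU x 1 hx.1 le_rfl hx.2]) (by linarith [tauV_nonneg hV hx])
  exact ⟨eq_zero_of_le_div_two_pow fun n => (hfin n).1,
    eq_zero_of_le_div_two_pow fun n => (hfin n).2⟩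

end HypSystem

theorem theorem1 (S : HypSystem) (hS : S.Admissible)
    (w₀ : ℝ → ℝ × ℝ) (hw₀ : MemLp w₀ ∞ unitVol)
    (U : ℝ → ℝ) (u v : ℝ → ℝ → ℝ) (hw : S.IsSolution w₀ U u v) :
    (∀ t, 0 ≤ t → ∃! a, S.IsFeedbackValue t (fun x => u x t) (fun x => v x t) a) ∧
    ((∀ t, 0 ≤ t → S.IsFeedbackValue t (fun x => u x t) (fun x => v x t) (U t)) →
      ∀ t, S.tauV 0 + S.tauU 1 ≤ t → ∀ x ∈ Icc (0 : ℝ) 1, u x t = 0 ∧ v x t = 0) := by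
  refine ⟨fun t ht => hw.broad.existsUnique_feedback hS ht, fun hfb t ht x hx => ?_⟩
  refine hw.broad.eq_zero_of_v_zero hS (fun s hs => ?_) ht hx
  have hs' : 0 ≤ s - S.tauV 0 := sub_nonneg.2 hs
  have := hw.broad.v_zero_of_feedback hS hs' (by rw [hw.bc_one _ hs']; exact hfb _ hs')
  rwa [sub_add_cancel] at this
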